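/- Let $f(r)=r-r^3$ and $g(r)=1-r^2$, let $\varepsilon>0$, $\kappa>0$ and $\tau>0$, and let $\Omega\subset\mathbb R^d$ be either * a bounded, connected, nonempty open set, with the homogeneous Neumann boundary condition $\partial w/\partial\mathbf n=0$ on $\partial\Omega$, or * an open box $\prod_{i=1}^d(a_i,b_i)$, $a_i<b_i$, with the periodic boundary condition. For $u\in C(\overline\Omega)$ with $\int_\Omega g(u)\,\mathrm dx\ne0$ put $$\mathcal N[u]=\kappa u+f(u)-\lambda_u\,g(u),\qquad \lambda_u=\frac{\int_\Omega f(u)\,\mathrm dx}{\int_\Omega g(u)\,\mathrm dx}.$$ Given $u_0\in C(\overline\Omega)$ (periodic in the periodic case), the ETD1 iterates with time step $\tau$ are the functions $u^n\in C(\overline\Omega)$ with $u^0=u_0$ and $u^{n+1}=w^n(\tau)$, where $w^n\in C([0,\tau]\times\overline\Omega)$ solves $$\partial_s w^n=\varepsilon^2\Delta w^n-\kappa w^n+\mathcal N[u^n]\quad\text{in }\Omega,\ s\in(0,\tau],\qquad w^n(\cdot,0)=u^n\quad\text{on }\overline\Omega,$$ subject to the chosen boundary condition. Here $\Delta w^n$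 is continuous on $(0,\tau]\times\overline\Omega$, and the Laplacian with its boundary condition is understood in the usual variational sense: for $0<s\le\tau$ the function $w^n(\cdot,s)$ is $C^1$ in $\Omega$ with square-integrable gradient (in the periodic case: has a periodic $C^1$ extension to $\mathbb R^d$), and $\int_\Omega\nabla w^n\cdot\nabla v\,\mathrm dx=-\int_\Omega\Delta w^n\,v\,\mathrm dx$ for all $v\in C^1(\Omega)\cap H^1(\Omega)$ (in the periodic case: for all periodic $v\in C^1(\mathbb R^d)$). Let $M_0=\int_\Omega u_0\,\mathrm dx$. Then, for every $\tau>0$, the ETD1 iterates conserve the mass exactly: $$\int_\Omega u^n\,\mathrm dx=M_0$$ for every $n\ge0$ such that the scheme is well defined up to $u^n$, i.e. $\int_\Omega g(u^m)\,\mathrm dx\neq0$ for all $m<n$. Moreover, if $\kappa\ge4$, $|u_0|\le1$ on $\overline\Omega$ and $|M_0|\ne|\Omega|$, then $\int_\Omega g(u^n)\,\mathrm dx\ne0$ for all $n\ge0$, so that $\int_\Omega u^n\,\mathrm dx=M_0$ holds for all $n\ge0$. -/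

import Mathlib

open MeasureTheory Set
open scoped Gradient

namespace AllenCahn

noncomputable section

/-- The nonlinearity `f(r) = r - r³` of the double-well potential. -/
def f (r : ℝ) : ℝ := r - r ^ 3

/-- The weight `g(r) = 1 - r²` of the local part of the Lagrange multiplier. -/
def g (r : ℝ) : ℝ := 1 - r ^ 2

/-- The mass `∫_Ω u dx`. -/
def mass {d : ℕ} (Ω : Set (EuclideanSpace ℝ (Fin d))) (u : EuclideanSpace ℝ (Fin d) → ℝ) : ℝ :=
  ∫ x in Ω, u x

/-- The integral `∫_Ω g(u) dx`, the denominator of the Lagrange multiplier. -/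
def gMass {d : ℕ} (Ω : Set (EuclideanSpace ℝ (Fin d))) (u : EuclideanSpace ℝ (Fin d) → ℝ) : ℝ :=
  ∫ x in Ω, g (u x)

/-- The Lagrange multiplier `λ_u = ∫_Ω f(u) dx / ∫_Ω g(u) dx`
(meaningful when `gMass Ω u ≠ 0`). -/
def multiplier {d : ℕ} (Ω : Set (EuclideanSpace ℝ (Fin d)))
    (u : EuclideanSpace ℝ (Fin d) → ℝ) : ℝ :=
  (∫ x in Ω, f (u x)) / gMass Ω u

/-- The stabilized nonlinear term `N[u] = κ u + f(u) - λ_u g(u)`. -/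
def nonlinearTerm {d : ℕ} (κ : ℝ) (Ω : Set (EuclideanSpace ℝ (Fin d)))
    (u : EuclideanSpace ℝ (Fin d) → ℝ) (x : EuclideanSpace ℝ (Fin d)) : ℝ :=
  κ * u x + f (u x) - multiplier Ω u * g (u x)

/-- `u` has period `L i` in the `i`-th coordinate direction, for every `i`. -/
def IsPeriodic {d : ℕ} (L : Fin d → ℝ) (u : EuclideanSpace ℝ (Fin d) → ℝ) : Prop :=
  ∀ (i : Fin d) (x : EuclideanSpace ℝ (Fin d)), u (x + EuclideanSpace.single i (L i)) = u x

/-- Homogeneous Neumann boundary condition, or periodic boundary condition on a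
rectangular box with side lengths `L i`. -/
inductive BoundaryCondition (d : ℕ) : Type
  | neumann : BoundaryCondition d
  | periodic (L : Fin d → ℝ) : BoundaryCondition d

namespace BoundaryCondition

/-- The domains carrying the boundary condition: bounded, open, connected (and nonempty) sets for
Neumann, open boxes `∏ (a i, a i + L i)` with `L i > 0` for periodic. -/
def IsDomain {d : ℕ} : BoundaryCondition d → Set (EuclideanSpace ℝ (Fin d)) → Prop
  | neumann, Ω => IsOpen Ω ∧ IsConnected Ω ∧ Bornology.IsBounded Ω
  | periodic L, Ω => (∀ i, 0 < L i) ∧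
      ∃ a : Fin d → ℝ, Ω = {x | ∀ i, x i ∈ Ioo (a i) (a i + L i)}

/-- The continuous functions in which the iterates live: `C(closure Ω)` for Neumann (values
outside `closure Ω` are immaterial), continuous periodic functions for periodic. -/
def StateSpace {d : ℕ} (B : BoundaryCondition d) (Ω : Set (EuclideanSpace ℝ (Fin d))) :
    Set (EuclideanSpace ℝ (Fin d) → ℝ) :=
  match B with
  | neumann => {u | ContinuousOn u (closure Ω)}
  | periodic L => {u | Continuous u ∧ IsPeriodic L u}

/-- The test functions: `C¹(Ω) ∩ H¹(Ω)` for Neumann, which is dense in `H¹(Ω)` for every open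
`Ω`; periodic `C¹` functions, dense in periodic `H¹`, for periodic. -/
def FormSpace {d : ℕ} (B : BoundaryCondition d) (Ω : Set (EuclideanSpace ℝ (Fin d))) :
    Set (EuclideanSpace ℝ (Fin d) → ℝ) :=
  match B with
  | neumann => {u | ContDiffOn ℝ 1 u Ω ∧ MemLp u 2 (volume.restrict Ω) ∧
      MemLp (fun x => ∇ u x) 2 (volume.restrict Ω)}
  | periodic L => {u | ContDiff ℝ 1 u ∧ IsPeriodic L u}

end BoundaryCondition

/-- `u` lies in the domain of the Laplace operator with the boundary condition `B`, realized on
continuous functions, and `Δ u = h`.  The boundary condition is imposed in the usual variational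
sense `∫_Ω ∇u · ∇v = - ∫_Ω h v` for all `v`: compactly supported `v` give `Δ u = h` in `Ω`,
the remaining `v` give `∂u/∂n = 0` on the boundary (Neumann) or the matching of `u` and of its
normal derivative on opposite faces (periodic).  A function with continuous distributional
Laplacian is `C¹` in the interior, so that interior `C¹` regularity costs nothing. -/
def HasLaplacian {d : ℕ} (B : BoundaryCondition d) (Ω : Set (EuclideanSpace ℝ (Fin d)))
    (u h : EuclideanSpace ℝ (Fin d) → ℝ) : Prop :=
  u ∈ B.StateSpace Ω ∧ u ∈ B.FormSpace Ω ∧ h ∈ B.StateSpace Ω ∧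
    ∀ v ∈ B.FormSpace Ω, ∫ x in Ω, inner ℝ (∇ u x) (∇ v x) = - ∫ x in Ω, h x * v x

/-- One step `u ↦ u'` of the first-order exponential time differencing scheme: `u' = w(τ)`, where
`w` is continuous on `[0, τ] × closure Ω`, solves
`∂_s w = ε² Δ w - κ w + N[u]` on `Ω × (0, τ]` with `w(0) = u`, subject to the boundary condition,
and `Δ w` is continuous on `(0, τ] × closure Ω`. -/
def IsETD1Step {d : ℕ} (B : BoundaryCondition d) (Ω : Set (EuclideanSpace ℝ (Fin d)))
    (ε κ τ : ℝ) (u u' : EuclideanSpace ℝ (Fin d) → ℝ) : Prop :=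
  ∃ w lap : ℝ → EuclideanSpace ℝ (Fin d) → ℝ,
    ContinuousOn (Function.uncurry w) (Icc 0 τ ×ˢ closure Ω) ∧
    ContinuousOn (Function.uncurry lap) (Ioc 0 τ ×ˢ closure Ω) ∧
    (∀ s ∈ Ioc 0 τ, HasLaplacian B Ω (w s) (lap s)) ∧
    (∀ s ∈ Ioc 0 τ, ∀ x ∈ Ω, HasDerivWithinAt (fun r => w r x)
      (ε ^ 2 * lap s x - κ * w s x + nonlinearTerm κ Ω u x) (Icc 0 τ) s) ∧
    (∀ x ∈ closure Ω, w 0 x = u x) ∧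
    (∀ x ∈ closure Ω, u' x = w τ x)

/-- `u 0, u 1, u 2, …` are ETD1 iterates with time step `τ`, started from `u₀`. -/
def IsETD1Solution {d : ℕ} (B : BoundaryCondition d) (Ω : Set (EuclideanSpace ℝ (Fin d)))
    (ε κ τ : ℝ) (u₀ : EuclideanSpace ℝ (Fin d) → ℝ)
    (u : ℕ → EuclideanSpace ℝ (Fin d) → ℝ) : Prop :=
  (∀ x ∈ closure Ω, u 0 x = u₀ x) ∧ (∀ n, u n ∈ B.StateSpace Ω) ∧
    ∀ n, IsETD1Step B Ω ε κ τ (u n) (u (n + 1))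

end

end AllenCahn

/-!
Testing the weak formulation of the Laplacian with the constant function `1` gives `∫ Δw = 0`, and
the choice of `λ_u` gives `∫ N[u] = κ ∫ u`. Hence the mass `m(s) = ∫ w(s)` of one ETD1 step solves
`m' = -κ (m - m(0))`, and so is constant (`mass_eq_of_isETD1Step`).

For the second assertion one shows that `|u| ≤ 1` is preserved by a step when `κ ≥ 4`. If `|u| ≤ 1`
then `f(u) = u g(u)` with `g(u) ≥ 0` gives `|λ_u| ≤ 1`, and an elementary inequality gives
`|N[u]| ≤ κ` (`abs_nonlinearTerm_le`). The bound on `w` is then the weak maximum principle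
(`le_one_of_parabolic`), applied to `w` and `-w`: testing with `v = ((w - 1)⁺)²` shows that the
energy `∫ ((w - 1)⁺)³` is nonincreasing in time, and it vanishes initially. The exponents are
chosen so that the test function and the energy density are `C¹` functions of `w`. Finally, if
`|u| ≤ 1` and `∫ g(u) = 0` then `u² = 1` everywhere, so `u` is constantly `1` or `-1` on the
connected set `Ω`, and the mass is `± |Ω|` (`gMass_ne_zero`).
-/

namespace AllenCahn

variable {d : ℕ} {B : BoundaryCondition d} {Ω : Set (EuclideanSpace ℝ (Fin d))}

/-! ### Domains and function spaces -/

theorem isOpen_of_isDomain (hΩ : B.IsDomain Ω) : IsOpen Ω := by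
  cases B with
  | neumann => exact hΩ.1
  | periodic L =>
    obtain ⟨-, a, rfl⟩ := hΩ
    simp only [ofPred_forall]
    exact isOpen_iInter_of_finite fun i => isOpen_Ioo.preimage (by fun_prop)

theorem isBounded_of_isDomain (hΩ : B.IsDomain Ω) : Bornology.IsBounded Ω := by
  cases B with
  | neumann => exact hΩ.2.2
  | periodic L =>
    obtain ⟨-, a, rfl⟩ := hΩ
    have h := (Bornology.IsBounded.pi fun i : Fin d => Metric.isBounded_Ioo (a i) (a i + L i))
    refine ((PiLp.antilipschitzWith_ofLp 2 (fun _ : Fin d => ℝ)).isBounded_preimage h).subset ?_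
    intro x hx i _
    exact hx i

theorem isConnected_of_isDomain (hΩ : B.IsDomain Ω) : IsConnected Ω := by
  cases B with
  | neumann => exact hΩ.2.1
  | periodic L =>
    obtain ⟨hL, a, rfl⟩ := hΩ
    refine ⟨⟨WithLp.toLp 2 fun i => a i + L i / 2, fun i => ?_⟩, Convex.isPreconnected ?_⟩
    · have := hL i
      constructor <;> simp <;> linarith
    · simp only [ofPred_forall]
      exact convex_iInter fun i =>
        (convex_Ioo (a i) (a i + L i)).linear_preimage
          (EuclideanSpace.proj (𝕜 := ℝ) i : EuclideanSpace ℝ (Fin d) →L[ℝ] ℝ).toLinearMap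

theorem isCompact_closure_of_isDomain (hΩ : B.IsDomain Ω) : IsCompact (closure Ω) :=
  (isBounded_of_isDomain hΩ).isCompact_closure

theorem integrableOn_of_continuousOn_closure (hΩ : B.IsDomain Ω)
    {u : EuclideanSpace ℝ (Fin d) → ℝ} (hu : ContinuousOn u (closure Ω)) :
    IntegrableOn u Ω :=
  (hu.integrableOn_compact (isCompact_closure_of_isDomain hΩ)).mono_set subset_closure

theorem continuousOn_of_mem_stateSpace {u : EuclideanSpace ℝ (Fin d) → ℝ}
    (hu : u ∈ B.StateSpace Ω) : ContinuousOn u (closure Ω) := by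
  cases B with
  | neumann => exact hu
  | periodic L => exact hu.1.continuousOn

theorem contDiffOn_of_mem_formSpace {u : EuclideanSpace ℝ (Fin d) → ℝ}
    (hu : u ∈ B.FormSpace Ω) : ContDiffOn ℝ 1 u Ω := by
  cases B with
  | neumann => exact hu.1
  | periodic L => exact hu.1.contDiffOn

theorem differentiableAt_of_mem_formSpace (hΩ : B.IsDomain Ω)
    {u : EuclideanSpace ℝ (Fin d) → ℝ} (hu : u ∈ B.FormSpace Ω) {x} (hx : x ∈ Ω) :
    DifferentiableAt ℝ u x :=
  ((contDiffOn_of_mem_formSpace hu).differentiableOn one_ne_zero).differentiableAt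
    ((isOpen_of_isDomain hΩ).mem_nhds hx)

theorem one_mem_formSpace (hΩ : B.IsDomain Ω) :
    (fun _ => (1 : ℝ)) ∈ B.FormSpace Ω := by
  have : IsFiniteMeasure (volume.restrict Ω) :=
    isFiniteMeasure_restrict.2 (isBounded_of_isDomain hΩ).measure_lt_top.ne
  cases B with
  | neumann =>
    refine ⟨contDiffOn_const, memLp_const _, ?_⟩
    simp only [gradient_fun_const]
    exact memLp_const _
  | periodic L => exact ⟨contDiff_const, fun _ _ => rfl⟩

theorem gradient_comp {p : ℝ → ℝ} {u : EuclideanSpace ℝ (Fin d) → ℝ} {p' : ℝ}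
    {x : EuclideanSpace ℝ (Fin d)} (hp : HasDerivAt p p' (u x)) (hu : DifferentiableAt ℝ u x) :
    ∇ (fun y => p (u y)) x = p' • ∇ u x := by
  have h : fderiv ℝ (fun y => p (u y)) x = p' • fderiv ℝ u x :=
    (hp.comp_hasFDerivAt x hu.hasFDerivAt).fderiv
  simp [gradient, h]

/-- A `C¹` function of a bounded form-space function is again an admissible test function. -/
theorem comp_mem_formSpace (hΩ : B.IsDomain Ω) {p p' : ℝ → ℝ}
    (hp : ∀ r, HasDerivAt p (p' r) r) (hp' : Continuous p') {u : EuclideanSpace ℝ (Fin d) → ℝ}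
    (hu : u ∈ B.StateSpace Ω) (hu' : u ∈ B.FormSpace Ω) :
    (fun x => p (u x)) ∈ B.FormSpace Ω := by
  have hpc : ContDiff ℝ 1 p := by
    refine contDiff_one_iff_deriv.2 ⟨fun r => (hp r).differentiableAt, ?_⟩
    rwa [show deriv p = p' from funext fun r => (hp r).deriv]
  have : IsFiniteMeasure (volume.restrict Ω) :=
    isFiniteMeasure_restrict.2 (isBounded_of_isDomain hΩ).measure_lt_top.ne
  have ho := isOpen_of_isDomain hΩ
  have hK := isCompact_closure_of_isDomain hΩ
  have huc := continuousOn_of_mem_stateSpace hu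
  cases B with
  | neumann =>
    refine ⟨hpc.comp_contDiffOn hu'.1, ?_, ?_⟩
    · have hc := hpc.continuous.comp_continuousOn huc
      obtain ⟨C, hC⟩ := hK.exists_bound_of_continuousOn hc
      refine MemLp.of_bound
        ((hc.mono subset_closure).aestronglyMeasurable ho.measurableSet) C ?_
      filter_upwards [ae_restrict_mem ho.measurableSet] with x hx using hC x (subset_closure hx)
    · have hc := hp'.comp_continuousOn huc
      obtain ⟨C, hC⟩ := hK.exists_bound_of_continuousOn hc
      have hae : (fun x => p' (u x) • ∇ u x) =ᵐ[volume.restrict Ω]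
          (fun x => ∇ (fun y => p (u y)) x) := by
        filter_upwards [ae_restrict_mem ho.measurableSet] with x hx
        exact (gradient_comp (hp _)
          (differentiableAt_of_mem_formSpace (B := .neumann) hΩ hu' hx)).symm
      refine MemLp.ae_eq hae (hu'.2.2.of_le_mul (c := C)
        (((hc.mono subset_closure).aestronglyMeasurable ho.measurableSet).smul
          hu'.2.2.aestronglyMeasurable) ?_)
      filter_upwards [ae_restrict_mem ho.measurableSet] with x hx
      rw [norm_smul]
      exact mul_le_mul_of_nonneg_right (hC x (subset_closure hx)) (norm_nonneg _)
  | periodic L =>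
    exact ⟨hpc.comp hu'.1, fun i x => congrArg p (hu'.2 i x)⟩

theorem HasLaplacian.neg (hΩ : B.IsDomain Ω) {u h : EuclideanSpace ℝ (Fin d) → ℝ}
    (H : HasLaplacian B Ω u h) : HasLaplacian B Ω (fun x => -u x) (fun x => -h x) := by
  obtain ⟨hu, hu', hh, hv⟩ := H
  have neg_mem : ∀ {v : EuclideanSpace ℝ (Fin d) → ℝ}, v ∈ B.StateSpace Ω →
      (fun x => -v x) ∈ B.StateSpace Ω := by
    intro v hv
    cases B with
    | neumann => exact ContinuousOn.neg hv
    | periodic L => exact ⟨hv.1.neg, fun i x => congrArg Neg.neg (hv.2 i x)⟩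
  refine ⟨neg_mem hu, comp_mem_formSpace hΩ (p := fun r => -r) (p' := fun _ => -1)
    (fun r => hasDerivAt_neg r) continuous_const hu hu', neg_mem hh, fun v hvm => ?_⟩
  have hg : ∀ x, ∇ (fun y => -u y) x = -∇ u x := fun x => by simp [gradient, fderiv_fun_neg]
  simp only [hg, inner_neg_left, neg_mul, integral_neg, hv v hvm]

theorem HasLaplacian.setIntegral_eq_zero (hΩ : B.IsDomain Ω)
    {u h : EuclideanSpace ℝ (Fin d) → ℝ} (H : HasLaplacian B Ω u h) : ∫ x in Ω, h x = 0 := by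
  simpa [gradient_fun_const, eq_comm] using H.2.2.2 _ (one_mem_formSpace hΩ)

/-- Dissipativity of the Laplacian: `∫ Δu p(u) = -∫ p'(u) |∇u|² ≤ 0` for nondecreasing `p`. -/
theorem HasLaplacian.setIntegral_mul_comp_nonpos (hΩ : B.IsDomain Ω)
    {u h : EuclideanSpace ℝ (Fin d) → ℝ} (H : HasLaplacian B Ω u h) {p p' : ℝ → ℝ}
    (hp : ∀ r, HasDerivAt p (p' r) r) (hp' : Continuous p') (hp0 : ∀ r, 0 ≤ p' r) :
    ∫ x in Ω, h x * p (u x) ≤ 0 := by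
  have h1 := H.2.2.2 _ (comp_mem_formSpace hΩ hp hp' H.1 H.2.1)
  have h2 : 0 ≤ ∫ x in Ω, inner ℝ (∇ u x) (∇ (fun y => p (u y)) x) := by
    refine setIntegral_nonneg (isOpen_of_isDomain hΩ).measurableSet fun x hx => ?_
    rw [gradient_comp (hp _) (differentiableAt_of_mem_formSpace hΩ H.2.1 hx), inner_smul_right]
    exact mul_nonneg (hp0 _) real_inner_self_nonneg
  linarith

/-! ### Integrals depending on time -/

theorem continuousOn_setIntegral_param (hΩ : B.IsDomain Ω) {τ : ℝ}
    {G : ℝ → EuclideanSpace ℝ (Fin d) → ℝ}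
    (hG : ContinuousOn (Function.uncurry G) (Icc 0 τ ×ˢ closure Ω)) :
    ContinuousOn (fun s => ∫ x in Ω, G s x) (Icc 0 τ) := by
  have : IsFiniteMeasure (volume.restrict Ω) :=
    isFiniteMeasure_restrict.2 (isBounded_of_isDomain hΩ).measure_lt_top.ne
  have hm := (isOpen_of_isDomain hΩ).measurableSet
  obtain ⟨C, hC⟩ := (isCompact_Icc.prod
    (isCompact_closure_of_isDomain hΩ)).exists_bound_of_continuousOn hG
  refine continuousOn_of_dominated (bound := fun _ => C) (fun s hs => ?_) (fun s hs => ?_)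
    (integrable_const _) ?_
  · exact (hG.uncurry_left s hs).mono subset_closure |>.aestronglyMeasurable hm
  · filter_upwards [ae_restrict_mem hm] with x hx using hC (s, x) ⟨hs, subset_closure hx⟩
  · filter_upwards [ae_restrict_mem hm] with x hx using hG.uncurry_right x (subset_closure hx)

theorem hasDerivAt_setIntegral_param (hΩ : B.IsDomain Ω) {τ : ℝ}
    {G G' : ℝ → EuclideanSpace ℝ (Fin d) → ℝ}
    (hG : ContinuousOn (Function.uncurry G) (Icc 0 τ ×ˢ closure Ω))
    (hG' : ContinuousOn (Function.uncurry G') (Ioc 0 τ ×ˢ closure Ω))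
    (hd : ∀ s ∈ Ioo 0 τ, ∀ x ∈ Ω, HasDerivAt (fun r => G r x) (G' s x) s)
    {s : ℝ} (hs : s ∈ Ioo 0 τ) :
    HasDerivAt (fun r => ∫ x in Ω, G r x) (∫ x in Ω, G' s x) s := by
  have : IsFiniteMeasure (volume.restrict Ω) :=
    isFiniteMeasure_restrict.2 (isBounded_of_isDomain hΩ).measure_lt_top.ne
  have hm := (isOpen_of_isDomain hΩ).measurableSet
  have hs2 : 0 < s / 2 := half_pos hs.1
  -- `G'` is bounded only away from time `0`.
  obtain ⟨C, hC⟩ := ((isCompact_Icc (a := s / 2) (b := τ)).prod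
    (isCompact_closure_of_isDomain hΩ)).exists_bound_of_continuousOn
    (hG'.mono (prod_mono_left fun r hr => ⟨hs2.trans_le hr.1, hr.2⟩))
  refine (hasDerivAt_integral_of_dominated_loc_of_deriv_le (s := Ioo (s / 2) τ)
    (bound := fun _ => C) (Ioo_mem_nhds (half_lt_self hs.1) hs.2) ?_ ?_ ?_ ?_
    (integrable_const _) ?_).2
  · filter_upwards [Ioo_mem_nhds hs.1 hs.2] with r hr
    exact ((hG.uncurry_left r (Ioo_subset_Icc_self hr)).mono
      subset_closure).aestronglyMeasurable hm
  · exact integrableOn_of_continuousOn_closure hΩ (hG.uncurry_left s (Ioo_subset_Icc_self hs))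
  · exact ((hG'.uncurry_left s (Ioo_subset_Ioc_self hs)).mono
      subset_closure).aestronglyMeasurable hm
  · filter_upwards [ae_restrict_mem hm] with x hx r hr
    exact hC (r, x) ⟨Ioo_subset_Icc_self hr, subset_closure hx⟩
  · filter_upwards [ae_restrict_mem hm] with x hx r hr
    exact hd r ⟨hs2.trans hr.1, hr.2⟩ x hx

theorem eqOn_zero_of_setIntegral_eq_zero (hΩ : B.IsDomain Ω)
    {φ : EuclideanSpace ℝ (Fin d) → ℝ} (hφ : ContinuousOn φ (closure Ω))
    (h0 : ∀ x ∈ Ω, 0 ≤ φ x) (hi : ∫ x in Ω, φ x = 0) : ∀ x ∈ closure Ω, φ x = 0 := by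
  have ho := isOpen_of_isDomain hΩ
  have hae : φ =ᵐ[volume.restrict Ω] fun _ => (0 : ℝ) :=
    (setIntegral_eq_zero_iff_of_nonneg_ae
      ((ae_restrict_mem ho.measurableSet).mono h0)
      (integrableOn_of_continuousOn_closure hΩ hφ)).1 hi
  have hEq : EqOn φ (fun _ => 0) Ω :=
    Measure.eqOn_open_of_ae_eq hae ho (hφ.mono subset_closure) continuousOn_const
  exact hEq.of_subset_closure hφ continuousOn_const subset_closure subset_rfl

/-! ### Conservation of mass -/

theorem f_continuous : Continuous f := by unfold f; fun_prop

theorem g_continuous : Continuous g := by unfold g; fun_prop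

theorem continuousOn_nonlinearTerm {κ : ℝ} {u : EuclideanSpace ℝ (Fin d) → ℝ}
    (hu : ContinuousOn u (closure Ω)) : ContinuousOn (nonlinearTerm κ Ω u) (closure Ω) := by
  unfold nonlinearTerm
  exact ((hu.const_mul _).add (f_continuous.comp_continuousOn hu)).sub
    ((g_continuous.comp_continuousOn hu).const_mul _)

theorem setIntegral_nonlinearTerm (hΩ : B.IsDomain Ω) {κ : ℝ}
    {u : EuclideanSpace ℝ (Fin d) → ℝ} (hu : ContinuousOn u (closure Ω))
    (hg : gMass Ω u ≠ 0) : ∫ x in Ω, nonlinearTerm κ Ω u x = κ * mass Ω u := by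
  have i1 := (integrableOn_of_continuousOn_closure hΩ hu).const_mul κ
  have i2 := integrableOn_of_continuousOn_closure hΩ (f_continuous.comp_continuousOn hu)
  have i3 := (integrableOn_of_continuousOn_closure hΩ
    (g_continuous.comp_continuousOn hu)).const_mul (multiplier Ω u)
  have h : ∫ x in Ω, nonlinearTerm κ Ω u x
      = κ * mass Ω u + (∫ x in Ω, f (u x)) - multiplier Ω u * gMass Ω u := by
    unfold nonlinearTerm mass gMass
    rw [← integral_const_mul, ← integral_const_mul]
    exact (integral_sub (i1.add i2) i3).trans (congrArg (· - _) (integral_add i1 i2))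
  rw [h, multiplier, div_mul_cancel₀ _ hg]
  ring

theorem mass_eq_of_isETD1Step (hΩ : B.IsDomain Ω) {ε κ τ : ℝ} (hτ : 0 < τ)
    {u u' : EuclideanSpace ℝ (Fin d) → ℝ} (hu : ContinuousOn u (closure Ω))
    (hg : gMass Ω u ≠ 0) (H : IsETD1Step B Ω ε κ τ u u') : mass Ω u' = mass Ω u := by
  obtain ⟨w, lap, hw, hlap, hL, hd, h0, h1⟩ := H
  have hm := (isOpen_of_isDomain hΩ).measurableSet
  set F : ℝ → EuclideanSpace ℝ (Fin d) → ℝ :=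
    fun s x => ε ^ 2 * lap s x - κ * w s x + nonlinearTerm κ Ω u x with hF
  have hN := continuousOn_nonlinearTerm (κ := κ) hu
  have hFc : ContinuousOn (Function.uncurry F) (Ioc 0 τ ×ˢ closure Ω) :=
    ((hlap.const_mul _).sub ((hw.mono (prod_mono_left Ioc_subset_Icc_self)).const_mul _)).add
      (hN.comp continuousOn_snd fun _ hy => hy.2)
  set m : ℝ → ℝ := fun s => ∫ x in Ω, w s x with hmdef
  have hmc : ContinuousOn m (Icc 0 τ) := continuousOn_setIntegral_param hΩ hw
  have hmd : ∀ s ∈ Ioo 0 τ, HasDerivAt m (-κ * (m s - mass Ω u)) s := by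
    intro s hs
    have hsc := Ioo_subset_Ioc_self hs
    have key := hasDerivAt_setIntegral_param hΩ hw hFc
      (fun r hr x hx => (hd r (Ioo_subset_Ioc_self hr) x hx).hasDerivAt
        (Icc_mem_nhds hr.1 hr.2)) hs
    convert key using 1
    have i1 := (integrableOn_of_continuousOn_closure hΩ (hlap.uncurry_left s hsc)).const_mul
      (ε ^ 2)
    have i2 := (integrableOn_of_continuousOn_closure hΩ
      (hw.uncurry_left s (Ioc_subset_Icc_self hsc))).const_mul κ
    have i3 := integrableOn_of_continuousOn_closure hΩ hN
    have e : ∫ x in Ω, F s x = (∫ x in Ω, ε ^ 2 * lap s x) - (∫ x in Ω, κ * w s x)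
        + ∫ x in Ω, nonlinearTerm κ Ω u x := by
      rw [← integral_sub i1 i2]
      exact integral_add (i1.sub i2) i3
    rw [e, integral_const_mul, integral_const_mul, (hL s hsc).setIntegral_eq_zero hΩ,
      setIntegral_nonlinearTerm hΩ hu hg]
    ring
  -- The integrating factor `exp (κ s)` makes the equation for `m - m(0)` exact.
  have hc : ContinuousOn (fun s => Real.exp (κ * s) * (m s - mass Ω u)) (Icc 0 τ) :=
    (by fun_prop : Continuous fun s : ℝ => Real.exp (κ * s)).continuousOn.mul
      (hmc.sub continuousOn_const)
  obtain ⟨c, hcm, hceq⟩ := exists_hasDerivAt_eq_slope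
    (fun s => Real.exp (κ * s) * (m s - mass Ω u)) (fun _ => 0) hτ hc fun s hs => by
      have h2 : HasDerivAt (fun t : ℝ => Real.exp (κ * t)) (Real.exp (κ * s) * κ) s := by
        simpa using ((hasDerivAt_id s).const_mul κ).exp
      exact (h2.mul ((hmd s hs).sub_const (mass Ω u))).congr_deriv (by ring)
  have hm0 : m 0 = mass Ω u := setIntegral_congr_fun hm fun x hx => h0 x (subset_closure hx)
  have hmτ : m τ = mass Ω u' :=
    (setIntegral_congr_fun hm fun x hx => h1 x (subset_closure hx)).symm
  rw [eq_comm, div_eq_zero_iff, hm0, hmτ] at hceq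
  rcases hceq with h | h
  · simpa [Real.exp_ne_zero, sub_eq_zero] using h
  · linarith

/-! ### The maximum principle -/

theorem hasDerivAt_posPart_pow (n : ℕ) (r : ℝ) :
    HasDerivAt (fun t : ℝ => max (t - 1) 0 ^ (n + 2))
      ((n + 2 : ℝ) * max (r - 1) 0 ^ (n + 1)) r := by
  have hne : ∀ y : ℝ, y ≠ 1 → HasDerivAt (fun t : ℝ => max (t - 1) 0 ^ (n + 2))
      ((n + 2 : ℝ) * max (y - 1) 0 ^ (n + 1)) y := by
    intro y hy
    rcases lt_or_gt_of_ne hy with h | h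
    · rw [max_eq_right (by linarith), zero_pow (by omega), mul_zero]
      refine (hasDerivAt_const y (0 : ℝ)).congr_of_eventuallyEq ?_
      filter_upwards [Iio_mem_nhds h] with t ht
      rw [max_eq_right (by linarith [mem_Iio.1 ht]), zero_pow (by omega)]
    · rw [max_eq_left (by linarith)]
      have h1 : HasDerivAt (fun t : ℝ => (t - 1) ^ (n + 2))
          ((n + 2 : ℝ) * (y - 1) ^ (n + 1)) y := by
        exact (((hasDerivAt_id y).sub_const 1).pow (n + 2)).congr_deriv (by simp)
      refine h1.congr_of_eventuallyEq ?_
      filter_upwards [Ioi_mem_nhds h] with t ht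
      rw [max_eq_left (by linarith [mem_Ioi.1 ht])]
  rcases eq_or_ne r 1 with rfl | h
  · exact hasDerivAt_of_hasDerivAt_of_ne (g := fun y : ℝ => (n + 2 : ℝ) * max (y - 1) 0 ^ (n + 1))
      hne (by fun_prop) (by fun_prop)
  · exact hne r h

/-- Weak maximum principle for `∂ₛ w = ε² Δ w - κ w + N` with `N ≤ κ`. -/
theorem le_one_of_parabolic (hΩ : B.IsDomain Ω) {ε κ τ : ℝ} (hκ : 0 < κ)
    {w lap : ℝ → EuclideanSpace ℝ (Fin d) → ℝ} {N : EuclideanSpace ℝ (Fin d) → ℝ}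
    (hw : ContinuousOn (Function.uncurry w) (Icc 0 τ ×ˢ closure Ω))
    (hlap : ContinuousOn (Function.uncurry lap) (Ioc 0 τ ×ˢ closure Ω))
    (hL : ∀ s ∈ Ioc 0 τ, HasLaplacian B Ω (w s) (lap s))
    (hN : ContinuousOn N (closure Ω)) (hNκ : ∀ x ∈ Ω, N x ≤ κ)
    (hd : ∀ s ∈ Ioo 0 τ, ∀ x ∈ Ω, HasDerivAt (fun r => w r x)
      (ε ^ 2 * lap s x - κ * w s x + N x) s)
    (h0 : ∀ x ∈ closure Ω, w 0 x ≤ 1) :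
    ∀ s ∈ Icc 0 τ, ∀ x ∈ closure Ω, w s x ≤ 1 := by
  have hm := (isOpen_of_isDomain hΩ).measurableSet
  have hFc : ContinuousOn
      (Function.uncurry fun s x => ε ^ 2 * lap s x - κ * w s x + N x)
      (Ioc 0 τ ×ˢ closure Ω) :=
    ((hlap.const_mul _).sub ((hw.mono (prod_mono_left Ioc_subset_Icc_self)).const_mul _)).add
      (hN.comp continuousOn_snd fun _ hy => hy.2)
  have hq : ∀ n : ℕ, Continuous fun t : ℝ => max (t - 1) 0 ^ n := fun n => by fun_prop
  have hp : ∀ r : ℝ, HasDerivAt (fun t : ℝ => max (t - 1) 0 ^ 2) (2 * max (r - 1) 0) r :=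
    fun r => by simpa using hasDerivAt_posPart_pow 0 r
  have hE : ∀ r : ℝ, HasDerivAt (fun t : ℝ => max (t - 1) 0 ^ 3) (3 * max (r - 1) 0 ^ 2) r :=
    fun r => by
      have := hasDerivAt_posPart_pow 1 r
      norm_num at this
      exact this
  set E : ℝ → ℝ := fun s => ∫ x in Ω, max (w s x - 1) 0 ^ 3 with hEdef
  have hcE : ContinuousOn (Function.uncurry fun s x => max (w s x - 1) 0 ^ 3)
      (Icc 0 τ ×ˢ closure Ω) := (hq 3).comp_continuousOn hw
  have hEc : ContinuousOn E (Icc 0 τ) := continuousOn_setIntegral_param hΩ hcE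
  have hcG : ContinuousOn (Function.uncurry fun s x =>
      3 * max (w s x - 1) 0 ^ 2 * (ε ^ 2 * lap s x - κ * w s x + N x)) (Ioc 0 τ ×ˢ closure Ω) :=
    (((hq 2).comp_continuousOn
      (hw.mono (prod_mono_left Ioc_subset_Icc_self))).const_mul 3).mul hFc
  have hEd : ∀ s ∈ Ioo 0 τ, ∃ e ≤ 0, HasDerivAt E e s := by
    intro s hs
    have hsc := Ioo_subset_Ioc_self hs
    have hws := hw.uncurry_left s (Ioc_subset_Icc_self hsc)
    refine ⟨_, ?_, hasDerivAt_setIntegral_param hΩ hcE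
      (G' := fun s x => 3 * max (w s x - 1) 0 ^ 2 * (ε ^ 2 * lap s x - κ * w s x + N x))
      hcG (fun r hr x hx => (hE (w r x)).comp (h := fun t => w t x) r (hd r hr x hx)) hs⟩
    have hi : ContinuousOn (fun x => lap s x * max (w s x - 1) 0 ^ 2) (closure Ω) :=
      (hlap.uncurry_left s hsc).mul ((hq 2).comp_continuousOn hws)
    have hle : ∫ x in Ω, 3 * max (w s x - 1) 0 ^ 2 * (ε ^ 2 * lap s x - κ * w s x + N x)
        ≤ ∫ x in Ω, 3 * ε ^ 2 * (lap s x * max (w s x - 1) 0 ^ 2) := by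
      refine setIntegral_mono_on (integrableOn_of_continuousOn_closure hΩ ?_)
        ((integrableOn_of_continuousOn_closure hΩ hi).const_mul _) hm fun x hx => ?_
      · exact hcG.uncurry_left s hsc
      · have hx1 : max (w s x - 1) 0 ^ 2 * (N x - κ * w s x) ≤ 0 := by
          rcases le_total (w s x - 1) 0 with h | h
          · simp [max_eq_right h]
          · refine mul_nonpos_of_nonneg_of_nonpos (sq_nonneg _) ?_
            nlinarith [hNκ x hx]
        linarith
    refine hle.trans ?_
    rw [integral_const_mul]
    exact mul_nonpos_of_nonneg_of_nonpos (by positivity)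
      ((hL s hsc).setIntegral_mul_comp_nonpos hΩ hp (by fun_prop) fun r => by positivity)
  have hanti : AntitoneOn E (Icc 0 τ) := by
    refine antitoneOn_of_deriv_nonpos (convex_Icc 0 τ) hEc ?_ ?_ <;> rw [interior_Icc]
    · intro s hs
      obtain ⟨e, -, he⟩ := hEd s hs
      exact he.differentiableAt.differentiableWithinAt
    · intro s hs
      obtain ⟨e, he0, he⟩ := hEd s hs
      rwa [he.deriv]
  intro s hs x hx
  have hE0 : E 0 = 0 := by
    refine setIntegral_eq_zero_of_forall_eq_zero fun y hy => ?_
    rw [max_eq_right (by linarith [h0 y (subset_closure hy)])]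
    norm_num
  have hEs : E s = 0 := by
    refine le_antisymm ?_ (setIntegral_nonneg hm fun y _ => by positivity)
    rw [← hE0]
    exact hanti ⟨le_rfl, hs.1.trans hs.2⟩ hs hs.1
  have hz := eqOn_zero_of_setIntegral_eq_zero hΩ (hcE.uncurry_left s hs)
    (fun y _ => by positivity) hEs x hx
  have hz' : max (w s x - 1) 0 = 0 := pow_eq_zero_iff (by norm_num) |>.1 hz
  linarith [max_eq_right_iff.1 hz']

/-! ### The bound on the iterates -/

theorem g_nonneg {r : ℝ} (hr : |r| ≤ 1) : 0 ≤ g r := by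
  unfold g
  linarith [(sq_le_one_iff_abs_le_one r).2 hr]

theorem abs_multiplier_le_one (hΩ : B.IsDomain Ω) {u : EuclideanSpace ℝ (Fin d) → ℝ}
    (hu : ContinuousOn u (closure Ω)) (hb : ∀ x ∈ closure Ω, |u x| ≤ 1) :
    |multiplier Ω u| ≤ 1 := by
  have hm := (isOpen_of_isDomain hΩ).measurableSet
  have hg0 : 0 ≤ gMass Ω u :=
    setIntegral_nonneg hm fun x hx => g_nonneg (hb x (subset_closure hx))
  have hle : |∫ x in Ω, f (u x)| ≤ gMass Ω u := by
    refine abs_integral_le_integral_abs.trans (setIntegral_mono_on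
      (integrableOn_of_continuousOn_closure hΩ (f_continuous.comp_continuousOn hu)).abs
      (integrableOn_of_continuousOn_closure hΩ (g_continuous.comp_continuousOn hu)) hm
      fun x hx => ?_)
    have hx1 := hb x (subset_closure hx)
    have hfg : f (u x) = u x * g (u x) := by unfold f g; ring
    rw [hfg, abs_mul, abs_of_nonneg (g_nonneg hx1)]
    exact mul_le_of_le_one_left (g_nonneg hx1) hx1
  rw [multiplier, abs_div, abs_of_nonneg hg0]
  exact div_le_one_of_le₀ hle hg0

/-- For `|r|, |l| ≤ 1` and `κ ≥ 4`, the factorization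
`κ ∓ (κ r + f r - l g r) = (1 ∓ r) (κ ∓ (r - l) (1 ± r))` has nonnegative factors. -/
theorem abs_stabilized_le {κ r l : ℝ} (hκ : 4 ≤ κ) (hr : |r| ≤ 1) (hl : |l| ≤ 1) :
    |κ * r + f r - l * g r| ≤ κ := by
  obtain ⟨hr1, hr2⟩ := abs_le.1 hr
  obtain ⟨hl1, hl2⟩ := abs_le.1 hl
  unfold f g
  have h1 : (r - l) * (1 + r) ≤ 4 := by nlinarith
  have h2 : -4 ≤ (r - l) * (1 - r) := by nlinarith
  have h3 : 0 ≤ (1 - r) * (κ - (r - l) * (1 + r)) := mul_nonneg (by linarith) (by linarith)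
  have h4 : 0 ≤ (1 + r) * (κ + (r - l) * (1 - r)) := mul_nonneg (by linarith) (by linarith)
  rw [abs_le]
  constructor <;> nlinarith

theorem abs_nonlinearTerm_le (hΩ : B.IsDomain Ω) {κ : ℝ} (hκ : 4 ≤ κ)
    {u : EuclideanSpace ℝ (Fin d) → ℝ} (hu : ContinuousOn u (closure Ω))
    (hb : ∀ x ∈ closure Ω, |u x| ≤ 1) {x} (hx : x ∈ closure Ω) :
    |nonlinearTerm κ Ω u x| ≤ κ :=
  abs_stabilized_le hκ (hb x hx) (abs_multiplier_le_one hΩ hu hb)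

theorem abs_le_one_of_isETD1Step (hΩ : B.IsDomain Ω) {ε κ τ : ℝ} (hτ : 0 < τ) (hκ : 4 ≤ κ)
    {u u' : EuclideanSpace ℝ (Fin d) → ℝ} (hu : ContinuousOn u (closure Ω))
    (hb : ∀ x ∈ closure Ω, |u x| ≤ 1) (H : IsETD1Step B Ω ε κ τ u u') :
    ∀ x ∈ closure Ω, |u' x| ≤ 1 := by
  obtain ⟨w, lap, hw, hlap, hL, hd, h0, h1⟩ := H
  have hκ0 : 0 < κ := by linarith
  have hN := continuousOn_nonlinearTerm (κ := κ) hu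
  have hd' : ∀ s ∈ Ioo 0 τ, ∀ x ∈ Ω, HasDerivAt (fun r => w r x)
      (ε ^ 2 * lap s x - κ * w s x + nonlinearTerm κ Ω u x) s := fun s hs x hx =>
    (hd s (Ioo_subset_Ioc_self hs) x hx).hasDerivAt (Icc_mem_nhds hs.1 hs.2)
  intro x hx
  have up := le_one_of_parabolic hΩ hκ0 hw hlap hL hN
    (fun y hy => (abs_le.1 (abs_nonlinearTerm_le hΩ hκ hu hb (subset_closure hy))).2) hd'
    (fun y hy => by rw [h0 y hy]; exact (abs_le.1 (hb y hy)).2) τ ⟨hτ.le, le_rfl⟩ x hx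
  have lo := le_one_of_parabolic (ε := ε) (w := fun s y => -w s y) (lap := fun s y => -lap s y)
    (N := fun y => -nonlinearTerm κ Ω u y) hΩ hκ0 hw.neg hlap.neg
    (fun s hs => (hL s hs).neg hΩ) hN.neg
    (fun y hy => by
      linarith [(abs_le.1 (abs_nonlinearTerm_le hΩ hκ hu hb (subset_closure hy))).1])
    (fun s hs y hy => by
      exact (hd' s hs y hy).neg.congr_deriv (by ring))
    (fun y hy => by
      rw [h0 y hy]
      linarith [(abs_le.1 (hb y hy)).1]) τ ⟨hτ.le, le_rfl⟩ x hx
  rw [h1 x hx, abs_le]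
  exact ⟨by linarith, up⟩

theorem gMass_ne_zero (hΩ : B.IsDomain Ω) {u : EuclideanSpace ℝ (Fin d) → ℝ}
    (hu : ContinuousOn u (closure Ω)) (hb : ∀ x ∈ closure Ω, |u x| ≤ 1)
    (hmass : |mass Ω u| ≠ volume.real Ω) : gMass Ω u ≠ 0 := by
  intro hg
  have hm := (isOpen_of_isDomain hΩ).measurableSet
  have hz := eqOn_zero_of_setIntegral_eq_zero hΩ (g_continuous.comp_continuousOn hu)
    (fun x hx => g_nonneg (hb x (subset_closure hx))) hg
  have hsq : EqOn (u ^ 2) 1 Ω := fun x hx => by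
    have h : g (u x) = 0 := hz x (subset_closure hx)
    unfold g at h
    simp only [Pi.pow_apply, Pi.one_apply]
    linarith
  apply hmass
  unfold mass
  rcases (isConnected_of_isDomain hΩ).isPreconnected.eq_one_or_eq_neg_one_of_sq_eq
    (hu.mono subset_closure) hsq with h | h
  · rw [setIntegral_congr_fun hm h]
    simp
  · rw [setIntegral_congr_fun hm h]
    simp

end AllenCahn

theorem mainTheorem5 {d : ℕ} (B : AllenCahn.BoundaryCondition d)
    (Ω : Set (EuclideanSpace ℝ (Fin d))) (hΩ : B.IsDomain Ω)
    (ε κ τ : ℝ) (hε : 0 < ε) (hκ : 0 < κ) (hτ : 0 < τ)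
    (u₀ : EuclideanSpace ℝ (Fin d) → ℝ) (u : ℕ → EuclideanSpace ℝ (Fin d) → ℝ)
    (hu : AllenCahn.IsETD1Solution B Ω ε κ τ u₀ u) :
    (∀ n, (∀ m < n, AllenCahn.gMass Ω (u m) ≠ 0) →
      AllenCahn.mass Ω (u n) = AllenCahn.mass Ω u₀) ∧
    (4 ≤ κ → (∀ x ∈ closure Ω, |u₀ x| ≤ 1) →
      |AllenCahn.mass Ω u₀| ≠ MeasureTheory.volume.real Ω →
      ∀ n, AllenCahn.gMass Ω (u n) ≠ 0 ∧
        AllenCahn.mass Ω (u n) = AllenCahn.mass Ω u₀) := by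
  obtain ⟨h0, hS, hstep⟩ := hu
  have hc : ∀ n, ContinuousOn (u n) (closure Ω) := fun n =>
    AllenCahn.continuousOn_of_mem_stateSpace (hS n)
  have hmass0 : AllenCahn.mass Ω (u 0) = AllenCahn.mass Ω u₀ :=
    setIntegral_congr_fun (AllenCahn.isOpen_of_isDomain hΩ).measurableSet
      fun x hx => h0 x (subset_closure hx)
  have hcons : ∀ n, (∀ m < n, AllenCahn.gMass Ω (u m) ≠ 0) →
      AllenCahn.mass Ω (u n) = AllenCahn.mass Ω u₀ := by
    intro n
    induction n with
    | zero => exact fun _ => hmass0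
    | succ n ih =>
      intro h
      rw [AllenCahn.mass_eq_of_isETD1Step hΩ hτ (hc n) (h n n.lt_succ_self) (hstep n)]
      exact ih fun m hm => h m (hm.trans n.lt_succ_self)
  refine ⟨hcons, fun hκ4 hb hM => ?_⟩
  have hbound : ∀ n, ∀ x ∈ closure Ω, |u n x| ≤ 1 := by
    intro n
    induction n with
    | zero => exact fun x hx => by rw [h0 x hx]; exact hb x hx
    | succ n ih => exact AllenCahn.abs_le_one_of_isETD1Step hΩ hτ hκ4 (hc n) ih (hstep n)
  have hg : ∀ n, AllenCahn.gMass Ω (u n) ≠ 0 := by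
    intro n
    induction n using Nat.strong_induction_on with
    | _ n ih =>
      exact AllenCahn.gMass_ne_zero hΩ (hc n) (hbound n) (by rwa [hcons n ih])
  exact fun n => ⟨hg n, hcons n fun m _ => hg m⟩
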